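/- Let $E$ be any set. Let $C^\infty(\mathbb{R}^E)$ be the ring of those functions $f:\mathbb{R}^E\to\mathbb{R}$ that factor as $f=f'\circ\pi_{E'}$ for some finite $E'\subseteq E$, where $\pi_{E'}:\mathbb{R}^E\to\mathbb{R}^{E'}$ is the restriction map and $f':\mathbb{R}^{E'}\to\mathbb{R}$ is smooth. It is a $C^\infty$-ring under pointwise operations. For $f\in C^\infty(\mathbb{R}^E)$ put $Z(f)=\{x\in\mathbb{R}^E: f(x)=0\}$; the sets $Z(f)$ are the zerosets of $\mathbb{R}^E$. A filter of zerosets is a family $\Phi$ of zerosets of $\mathbb{R}^E$ that contains $\mathbb{R}^E$, is closed under binary intersections, and contains every zeroset that includes a member of $\Phi$. It is proper if it is not the family of all zerosets, maximal if it is maximal for inclusion among the proper filters of zerosets, and prime if, for all zerosets $F,G$, $F\cup G\in\Phi$ implies $F\in\Phi$ or $G\in\Phi$. An ideal $I$ of $C^\infty(\mathbb{R}^E)$ is called prime if $fg\in I$ implies $f\in I$ or $g\in I$; in both cases properness is not part of primality and is stated separately. Maximal ideals are proper, as usual. For an ideal $I$ of a $C^\infty$-ring $A$, the $C^\infty$-radical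 of $I$ is $\sqrt[\infty]{I}=\{a\in A: (A/I)\{(a+I)^{-1}\}\cong 0\}$, where $B\{b^{-1}\}$ denotes the $C^\infty$-ring of fractions of $B$, i.e. the target of the universal $C^\infty$-homomorphism from $B$ that makes $b$ invertible; $I$ is $C^\infty$-radical if $\sqrt[\infty]{I}=I$. For an ideal $I$ of $C^\infty(\mathbb{R}^E)$ and a filter of zerosets $\Phi$ put $$\widehat{I}=\{Z(f): f\in I\},\qquad \widecheck{\Phi}=\{f\in C^\infty(\mathbb{R}^E): Z(f)\in\Phi\}.$$ Then $\widehat{I}$ is a filter of zerosets, $\widecheck{\Phi}$ is an ideal, and the two maps form a Galois connection for inclusion: $\widehat{I}\subseteq\Phi\iff I\subseteq\widecheck{\Phi}$. Moreover, $I\mapsto\widehat{I}$ and $\Phi\mapsto\widecheck{\Phi}$ restrict to mutually inverse bijections, which in (a) and (c) are isomorphisms of posets ordered by inclusion, between: (a) the $C^\infty$-radical ideals of $C^\infty(\mathbb{R}^E)$ and the filters of zerosets of $\mathbb{R}^E$; and likewise the proper $C^\infty$-radical ideals and the proper filters of zerosets; (b) the maximal ideals of $C^\infty(\mathbb{R}^E)$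 and the maximal filters of zerosets of $\mathbb{R}^E$; (c) the prime $C^\infty$-radical ideals of $C^\infty(\mathbb{R}^E)$ and the prime filters of zerosets of $\mathbb{R}^E$; and likewise the proper prime $C^\infty$-radical ideals and the proper prime filters of zerosets. -/

import Mathlib

open scoped ContDiff

universe u

/-! ### C∞-rings -/

/-- The smooth functions `ℝⁿ → ℝ`: the `n`-ary operation symbols of the theory of C∞-rings. -/
abbrev SmoothFn (n : ℕ) : Type := {f : (Fin n → ℝ) → ℝ // ContDiff ℝ ∞ f}

namespace SmoothFn

/-- The projection onto the `k`-th coordinate. -/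
def proj {n : ℕ} (k : Fin n) : SmoothFn n := ⟨fun x => x k, contDiff_apply ℝ ℝ k⟩

/-- The composite `h ∘ (g₁, …, gₙ)`. -/
def comp {m n : ℕ} (h : SmoothFn n) (g : Fin n → SmoothFn m) : SmoothFn m :=
  ⟨fun x => h.1 fun i => (g i).1 x, h.2.comp (contDiff_pi.2 fun i => (g i).2)⟩

/-- Addition, as a smooth function of two variables. -/
def add : SmoothFn 2 := ⟨fun x => x 0 + x 1, (contDiff_apply ℝ ℝ 0).add (contDiff_apply ℝ ℝ 1)⟩

/-- Multiplication, as a smooth function of two variables. -/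
def mul : SmoothFn 2 := ⟨fun x => x 0 * x 1, (contDiff_apply ℝ ℝ 0).mul (contDiff_apply ℝ ℝ 1)⟩

end SmoothFn

/-- A C∞-ring structure on `A`: every smooth `f : ℝⁿ → ℝ` is interpreted as an operation
`Aⁿ → A`, projections and composites being preserved.  The last two fields say that the given
commutative ring structure of `A` is the underlying ring of the C∞-ring. -/
class CInfRing (A : Type u) [CommRing A] where
  op : ∀ {n : ℕ}, SmoothFn n → (Fin n → A) → A
  op_proj : ∀ {n : ℕ} (k : Fin n) (a : Fin n → A), op (SmoothFn.proj k) a = a k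
  op_comp : ∀ {m n : ℕ} (h : SmoothFn n) (g : Fin n → SmoothFn m) (a : Fin m → A),
    op (h.comp g) a = op h fun i => op (g i) a
  op_add : ∀ a b : A, op SmoothFn.add ![a, b] = a + b
  op_mul : ∀ a b : A, op SmoothFn.mul ![a, b] = a * b

/-- C∞-homomorphisms: maps that commute with all the smooth operations. -/
def IsCInfHom {A B : Type u} [CommRing A] [CInfRing A] [CommRing B] [CInfRing B]
    (φ : A → B) : Prop :=
  ∀ (n : ℕ) (f : SmoothFn n) (a : Fin n → A),
    φ (CInfRing.op f a) = CInfRing.op f fun i => φ (a i)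

/-! ### Quotients of C∞-rings

The smooth operations pass to the quotient by a ring-theoretic ideal, by the lemma of Hadamard. -/

theorem contDiff_integral_unitInterval {P F : Type} [NormedAddCommGroup P] [NormedSpace ℝ P]
    [NormedAddCommGroup F] [NormedSpace ℝ F] [CompleteSpace F]
    (g : P → ℝ → F) (hg : ContDiff ℝ ∞ fun q : P × ℝ => g q.1 q.2) :
    ContDiff ℝ ∞ fun p => ∫ t in (0 : ℝ)..1, g p t := by
  let χ : ContDiffBump (0 : ℝ) := ⟨1, 2, by norm_num, by norm_num⟩
  let h : ℝ → ℝ := Set.indicator (Set.Ioc 0 1) fun _ => 1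
  have hloc : MeasureTheory.LocallyIntegrable h MeasureTheory.volume := by
    refine MeasureTheory.Integrable.locallyIntegrable ?_
    rw [MeasureTheory.integrable_indicator_iff measurableSet_Ioc]
    exact MeasureTheory.integrableOn_const (by simp)
  have key := MeasureTheory.contDiffOn_convolution_right_with_param_comp (n := ⊤)
    (μ := MeasureTheory.volume) (ContinuousLinearMap.lsmul ℝ ℝ : ℝ →L[ℝ] F →L[ℝ] F)
    (s := (Set.univ : Set P)) (v := fun _ => (0 : ℝ)) contDiffOn_const (f := h)
    (g := fun p s => χ s • g p (-s)) (k := Metric.closedBall 0 2)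
    isOpen_univ (isCompact_closedBall _ _) (by
      intro p x _ hx
      have : χ x = 0 := χ.zero_of_le_dist (by
        simp only [Metric.mem_closedBall, not_le] at hx
        exact hx.le)
      simp [this]) hloc (by
      refine ContDiff.contDiffOn ?_
      refine ContDiff.smul (χ.contDiff.comp contDiff_snd) ?_
      exact hg.comp (contDiff_fst.prodMk contDiff_snd.neg))
  rw [contDiffOn_univ] at key
  convert key using 2 with p
  rw [MeasureTheory.convolution_def, intervalIntegral.integral_of_le zero_le_one,
    ← MeasureTheory.integral_indicator measurableSet_Ioc]
  congr 1
  ext t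
  by_cases ht : t ∈ Set.Ioc (0 : ℝ) 1
  · have : χ (-t) = 1 := χ.one_of_mem_closedBall (by
      simp only [Metric.mem_closedBall, dist_zero_right, norm_neg, Real.norm_eq_abs]
      exact abs_le.2 ⟨by linarith [ht.1], ht.2⟩)
    simp [h, ht, this]
  · simp [h, ht]

/-- Hadamard's lemma: `f(x) = f(y) + ∑ᵢ (xᵢ - yᵢ) gᵢ(x, y)` with smooth `gᵢ`. -/
theorem SmoothFn.hadamard {n : ℕ} (f : SmoothFn n) :
    ∃ g : Fin n → SmoothFn (n + n), ∀ z : Fin (n + n) → ℝ,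
      f.1 (fun i => z (Fin.castAdd n i)) = f.1 (fun i => z (Fin.natAdd n i)) +
        ∑ i, (z (Fin.castAdd n i) - z (Fin.natAdd n i)) * (g i).1 z := by
  let X : (Fin (n + n) → ℝ) → Fin n → ℝ := fun z i => z (Fin.castAdd n i)
  let Y : (Fin (n + n) → ℝ) → Fin n → ℝ := fun z i => z (Fin.natAdd n i)
  have hX : ContDiff ℝ ∞ X := contDiff_pi.2 fun i => contDiff_apply ℝ ℝ _
  have hY : ContDiff ℝ ∞ Y := contDiff_pi.2 fun i => contDiff_apply ℝ ℝ _
  let G : (Fin (n + n) → ℝ) → (Fin n → ℝ) →L[ℝ] ℝ := fun z =>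
    ∫ t in (0 : ℝ)..1, fderiv ℝ f.1 (Y z + t • (X z - Y z))
  have hf' : ContDiff ℝ ∞ (fderiv ℝ f.1) := f.2.fderiv_right (by simp)
  have hG : ContDiff ℝ ∞ G := by
    apply contDiff_integral_unitInterval
    refine hf'.comp ?_
    exact (hY.comp contDiff_fst).add
      (contDiff_snd.smul ((hX.comp contDiff_fst).sub (hY.comp contDiff_fst)))
  refine ⟨fun i => ⟨fun z => G z (Pi.single i 1), hG.clm_apply contDiff_const⟩, fun z => ?_⟩
  have hsum : ∑ i, (X z i - Y z i) * G z (Pi.single i 1) = G z (X z - Y z) := by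
    conv_rhs => rw [← Finset.univ_sum_single (X z - Y z)]
    rw [map_sum]
    refine Finset.sum_congr rfl fun i _ => ?_
    rw [← smul_eq_mul, ← map_smul]
    congr 1
    ext j
    simp [Pi.single_apply]
  have hcont : Continuous fun t : ℝ => fderiv ℝ f.1 (Y z + t • (X z - Y z)) :=
    hf'.continuous.comp (by fun_prop)
  have hint : G z (X z - Y z) = f.1 (X z) - f.1 (Y z) := by
    change (∫ t in (0 : ℝ)..1, fderiv ℝ f.1 (Y z + t • (X z - Y z))) (X z - Y z) = _
    rw [ContinuousLinearMap.intervalIntegral_apply (hcont.intervalIntegrable _ _)]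
    rw [intervalIntegral.integral_eq_sub_of_hasDerivAt
      (f := fun t : ℝ => f.1 (Y z + t • (X z - Y z)))]
    · simp
    · intro t _
      have h1 : HasFDerivAt f.1 (fderiv ℝ f.1 (Y z + t • (X z - Y z)))
          (Y z + t • (X z - Y z)) :=
        (f.2.differentiable (by simp)).differentiableAt.hasFDerivAt
      have h2 : HasDerivAt (fun t : ℝ => Y z + t • (X z - Y z)) (X z - Y z) t := by
        simpa using ((hasDerivAt_id t).smul_const (X z - Y z)).const_add (Y z)
      exact h1.comp_hasDerivAt t h2
    · exact (hcont.clm_apply continuous_const).intervalIntegrable _ _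
  change f.1 (X z) = f.1 (Y z) + ∑ i, (X z i - Y z i) * G z (Pi.single i 1)
  rw [hsum, hint]
  ring

namespace CInfRing

variable {A : Type u} [CommRing A] [CInfRing A]

theorem op_add_fn {n : ℕ} (f g h : SmoothFn n) (H : ∀ x, h.1 x = f.1 x + g.1 x)
    (a : Fin n → A) : op h a = op f a + op g a := by
  have : h = SmoothFn.add.comp ![f, g] := Subtype.ext (funext fun x => by
    simp [SmoothFn.comp, SmoothFn.add, H])
  rw [this, op_comp, ← op_add]
  congr 1
  ext i
  fin_cases i <;> rfl

theorem op_mul_fn {n : ℕ} (f g h : SmoothFn n) (H : ∀ x, h.1 x = f.1 x * g.1 x)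
    (a : Fin n → A) : op h a = op f a * op g a := by
  have : h = SmoothFn.mul.comp ![f, g] := Subtype.ext (funext fun x => by
    simp [SmoothFn.comp, SmoothFn.mul, H])
  rw [this, op_comp, ← op_mul]
  congr 1
  ext i
  fin_cases i <;> rfl

theorem op_sum_fn {n : ℕ} {ι : Type} (s : Finset ι) (f : ι → SmoothFn n) (h : SmoothFn n)
    (H : ∀ x, h.1 x = ∑ i ∈ s, (f i).1 x) (a : Fin n → A) :
    op h a = ∑ i ∈ s, op (f i) a := by
  classical
  induction s using Finset.induction_on generalizing h with
  | empty =>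
    have := op_add_fn h h h (by intro x; simp [H]) a
    simpa using this
  | insert i s hi ih =>
    rw [Finset.sum_insert hi, ← ih ⟨fun x => ∑ i ∈ s, (f i).1 x,
      ContDiff.sum fun i _ => (f i).2⟩ fun _ => rfl]
    exact op_add_fn _ _ _ (fun x => by simp [H, Finset.sum_insert hi]) a

theorem op_sub_mem (I : Ideal A) {n : ℕ} (f : SmoothFn n) (a b : Fin n → A)
    (hab : ∀ i, a i - b i ∈ I) : op f a - op f b ∈ I := by
  obtain ⟨g, hg⟩ := f.hadamard
  let c : Fin (n + n) → A := Fin.append a b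
  let x : Fin n → SmoothFn (n + n) := fun i => SmoothFn.proj (Fin.castAdd n i)
  let y : Fin n → SmoothFn (n + n) := fun i => SmoothFn.proj (Fin.natAdd n i)
  let d : Fin n → SmoothFn (n + n) := fun i =>
    ⟨fun z => (x i).1 z - (y i).1 z, (x i).2.sub (y i).2⟩
  let p : Fin n → SmoothFn (n + n) := fun i =>
    ⟨fun z => (d i).1 z * (g i).1 z, (d i).2.mul (g i).2⟩
  let s : SmoothFn (n + n) := ⟨fun z => ∑ i, (p i).1 z, ContDiff.sum fun i _ => (p i).2⟩
  have hx : ∀ i, op (x i) c = a i := fun i => by simp [x, c, op_proj]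
  have hy : ∀ i, op (y i) c = b i := fun i => by
    simp only [y, c, op_proj, Fin.append_right]
  have hfx : op (f.comp x) c = op f a := by simp only [op_comp, hx]
  have hfy : op (f.comp y) c = op f b := by simp only [op_comp, hy]
  have hd : ∀ i, op (d i) c = a i - b i := fun i => by
    have := op_add_fn (d i) (y i) (x i) (fun z => by simp [d]) c
    rw [hx, hy] at this
    rw [this]; ring
  have h1 := op_add_fn (f.comp y) s (f.comp x) (fun z => hg z) c
  rw [hfx, hfy, op_sum_fn Finset.univ p s (fun _ => rfl)] at h1
  rw [h1, add_sub_cancel_left]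
  refine I.sum_mem fun i _ => ?_
  rw [op_mul_fn (d i) (g i) (p i) (fun _ => rfl), hd]
  exact I.mul_mem_right _ (hab i)

/-- The operation induced by `f` on `A ⧸ I`, computed on representatives. -/
noncomputable def quotientOp (I : Ideal A) {n : ℕ} (f : SmoothFn n) (q : Fin n → A ⧸ I) : A ⧸ I :=
  Ideal.Quotient.mk I (op f fun i => (q i).out)

theorem quotientOp_mk (I : Ideal A) {n : ℕ} (f : SmoothFn n) (a : Fin n → A) :
    quotientOp I f (fun i => Ideal.Quotient.mk I (a i)) = Ideal.Quotient.mk I (op f a) := by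
  refine Ideal.Quotient.eq.2 (op_sub_mem I f _ _ fun i => ?_)
  exact Ideal.Quotient.eq.1 (Quotient.out_eq' (Ideal.Quotient.mk I (a i)))

/-- The C∞-ring `A ⧸ I`; its operations are the unique ones for which the projection
`A → A ⧸ I` is a C∞-homomorphism (`quotientOp_mk`). -/
noncomputable instance quotient (I : Ideal A) : CInfRing (A ⧸ I) where
  op f q := quotientOp I f q
  op_proj k q := by
    choose a ha using fun i => Ideal.Quotient.mk_surjective (q i)
    obtain rfl : (fun i => Ideal.Quotient.mk I (a i)) = q := funext ha
    rw [quotientOp_mk, op_proj]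
  op_comp h g q := by
    choose a ha using fun i => Ideal.Quotient.mk_surjective (q i)
    obtain rfl : (fun i => Ideal.Quotient.mk I (a i)) = q := funext ha
    simp only [quotientOp_mk, op_comp]
  op_add a b := by
    obtain ⟨a, rfl⟩ := Ideal.Quotient.mk_surjective a
    obtain ⟨b, rfl⟩ := Ideal.Quotient.mk_surjective b
    have h : (![Ideal.Quotient.mk I a, Ideal.Quotient.mk I b] : Fin 2 → A ⧸ I) =
        fun i => Ideal.Quotient.mk I (![a, b] i) := by
      ext i; fin_cases i <;> rfl
    rw [h, quotientOp_mk, op_add, map_add]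
  op_mul a b := by
    obtain ⟨a, rfl⟩ := Ideal.Quotient.mk_surjective a
    obtain ⟨b, rfl⟩ := Ideal.Quotient.mk_surjective b
    have h : (![Ideal.Quotient.mk I a, Ideal.Quotient.mk I b] : Fin 2 → A ⧸ I) =
        fun i => Ideal.Quotient.mk I (![a, b] i) := by
      ext i; fin_cases i <;> rfl
    rw [h, quotientOp_mk, op_mul, map_mul]

end CInfRing

/-! ### C∞-rings of fractions and the C∞-radical -/

/-- `η : A → F` is the C∞-ring of fractions `A{S⁻¹}`: it is universal among the C∞-homomorphisms
out of `A` that send the elements of `S` to units. -/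
structure IsCInfFractions {A F : Type u} [CommRing A] [CInfRing A] [CommRing F] [CInfRing F]
    (S : Set A) (η : A → F) : Prop where
  isCInfHom : IsCInfHom η
  isUnit : ∀ s ∈ S, IsUnit (η s)
  existsUnique_lift : ∀ (B : Type u) [CommRing B] [CInfRing B] (φ : A → B), IsCInfHom φ →
    (∀ s ∈ S, IsUnit (φ s)) → ∃! ψ : F → B, IsCInfHom ψ ∧ ∀ a, ψ (η a) = φ a

/-- The C∞-radical of `I`: the elements `a` such that `(A/I){(a+I)⁻¹}` is the zero ring. -/
def cinfRadical {A : Type u} [CommRing A] [CInfRing A] (I : Ideal A) : Set A :=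
  {a | ∃ (F : Type u) (_ : CommRing F) (_ : CInfRing F) (η : A ⧸ I → F),
    IsCInfFractions {Ideal.Quotient.mk I a} η ∧ Subsingleton F}

/-- `I` is a C∞-radical ideal if it is equal to its C∞-radical. -/
def IsCInfRadical {A : Type u} [CommRing A] [CInfRing A] (I : Ideal A) : Prop :=
  cinfRadical I = (I : Set A)

/-! ### The C∞-ring `C∞(ℝ^E)` -/

/-- `f : ℝ^E → ℝ` is smooth if it factors as the projection to `ℝ^{E'}` for a finite `E' ⊆ E`
followed by a smooth function on `ℝ^{E'}`. -/
def IsSmoothOnPower (E : Type u) (f : (E → ℝ) → ℝ) : Prop :=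
  ∃ (E' : Finset E) (f' : (E' → ℝ) → ℝ), ContDiff ℝ ∞ f' ∧ ∀ x, f x = f' fun e => x e

namespace IsSmoothOnPower

variable {E : Type u}

theorem op {n : ℕ} (h : SmoothFn n) (f : Fin n → (E → ℝ) → ℝ)
    (hf : ∀ i, IsSmoothOnPower E (f i)) : IsSmoothOnPower E fun x => h.1 fun i => f i x := by
  classical
  choose D g hg hfg using hf
  have hD : ∀ i, ∀ e ∈ D i, e ∈ Finset.univ.biUnion D := fun i e he =>
    Finset.mem_biUnion.2 ⟨i, Finset.mem_univ _, he⟩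
  refine ⟨Finset.univ.biUnion D, fun y => h.1 fun i => g i fun e => y ⟨e, hD i e e.2⟩,
    h.2.comp (contDiff_pi.2 fun i => (hg i).comp (contDiff_pi.2 fun e => contDiff_apply ℝ ℝ _)),
    fun x => by simp only [hfg]⟩

theorem const (c : ℝ) : IsSmoothOnPower E fun _ => c :=
  ⟨∅, fun _ => c, contDiff_const, fun _ => rfl⟩

theorem add {f g : (E → ℝ) → ℝ} (hf : IsSmoothOnPower E f) (hg : IsSmoothOnPower E g) :
    IsSmoothOnPower E (f + g) :=
  op SmoothFn.add ![f, g] (Fin.forall_fin_two.2 ⟨hf, hg⟩)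

theorem mul {f g : (E → ℝ) → ℝ} (hf : IsSmoothOnPower E f) (hg : IsSmoothOnPower E g) :
    IsSmoothOnPower E (f * g) :=
  op SmoothFn.mul ![f, g] (Fin.forall_fin_two.2 ⟨hf, hg⟩)

theorem neg {f : (E → ℝ) → ℝ} (hf : IsSmoothOnPower E f) : IsSmoothOnPower E (-f) :=
  op (⟨fun x => -x 0, (contDiff_apply ℝ ℝ 0).neg⟩ : SmoothFn 1) (fun _ => f) fun _ => hf

end IsSmoothOnPower

/-- The ring `C∞(ℝ^E)` of smooth functions on `ℝ^E`, with the pointwise ring structure. -/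
def CInfPower (E : Type u) : Subring ((E → ℝ) → ℝ) where
  carrier := {f | IsSmoothOnPower E f}
  mul_mem' := IsSmoothOnPower.mul
  one_mem' := IsSmoothOnPower.const 1
  add_mem' := IsSmoothOnPower.add
  zero_mem' := IsSmoothOnPower.const 0
  neg_mem' := IsSmoothOnPower.neg

/-- `C∞(ℝ^E)` is a C∞-ring with the pointwise operations. -/
instance CInfPower.instCInfRing (E : Type u) : CInfRing (CInfPower E) where
  op h f := ⟨fun x => h.1 fun i => (f i).1 x, IsSmoothOnPower.op h _ fun i => (f i).2⟩
  op_proj _ _ := rfl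
  op_comp _ _ _ := rfl
  op_add _ _ := rfl
  op_mul _ _ := rfl

/-! ### Zerosets and filters of zerosets -/

/-- The zeroset `Z(f) ⊆ ℝ^E` of `f ∈ C∞(ℝ^E)`. -/
def zeroset {E : Type u} (f : CInfPower E) : Set (E → ℝ) := {x | f.1 x = 0}

/-- `X ⊆ ℝ^E` is a zeroset. -/
def IsZeroset {E : Type u} (X : Set (E → ℝ)) : Prop := ∃ f : CInfPower E, X = zeroset f

/-- A (possibly improper) filter of zerosets of `ℝ^E`. -/
@[ext]
structure ZerosetFilter (E : Type u) where
  sets : Set (Set (E → ℝ))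
  isZeroset : ∀ F ∈ sets, IsZeroset F
  univ_mem : Set.univ ∈ sets
  inter_mem : ∀ F ∈ sets, ∀ G ∈ sets, F ∩ G ∈ sets
  superset_mem : ∀ F ∈ sets, ∀ G, IsZeroset G → F ⊆ G → G ∈ sets

namespace ZerosetFilter

variable {E : Type u}

/-- Filters of zerosets are ordered by inclusion of the families of sets (unlike Mathlib's
`Filter`). -/
instance : PartialOrder (ZerosetFilter E) :=
  PartialOrder.lift sets fun _ _ => ZerosetFilter.ext

/-- A filter of zerosets is proper if it is not the family of all zerosets. -/
def IsProper (Φ : ZerosetFilter E) : Prop := Φ.sets ≠ {F | IsZeroset F}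

/-- A maximal filter of zerosets: a maximal element among the proper ones. -/
def IsMaximal (Φ : ZerosetFilter E) : Prop := Maximal IsProper Φ

/-- The primality condition on filters of zerosets; properness is not part of it. -/
def IsPrime (Φ : ZerosetFilter E) : Prop :=
  ∀ F G, IsZeroset F → IsZeroset G → F ∪ G ∈ Φ.sets → F ∈ Φ.sets ∨ G ∈ Φ.sets

end ZerosetFilter

/-- The filter of zerosets `Î = {Z(f) : f ∈ I}` of an ideal `I`. -/
def hatFilter {E : Type u} (I : Ideal (CInfPower E)) : ZerosetFilter E where
  sets := {F | ∃ f ∈ I, F = zeroset f}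
  isZeroset := fun _ ⟨f, _, hf⟩ => ⟨f, hf⟩
  univ_mem := ⟨0, I.zero_mem, by ext x; simp [zeroset]⟩
  inter_mem := by
    rintro _ ⟨f, hf, rfl⟩ _ ⟨g, hg, rfl⟩
    refine ⟨f * f + g * g, I.add_mem (I.mul_mem_left _ hf) (I.mul_mem_left _ hg), ?_⟩
    ext x
    simp [zeroset, mul_self_add_mul_self_eq_zero]
  superset_mem := by
    rintro _ ⟨f, hf, rfl⟩ _ ⟨g, rfl⟩ hfg
    refine ⟨g * f, I.mul_mem_left _ hf, ?_⟩
    ext x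
    have := @hfg x
    simp only [zeroset, Set.mem_ofPred_eq, Subring.coe_mul, Pi.mul_apply, mul_eq_zero] at this ⊢
    tauto

/-- The ideal `Φ̌ = {f : Z(f) ∈ Φ}` of a filter of zerosets `Φ`. -/
def checkIdeal {E : Type u} (Φ : ZerosetFilter E) : Ideal (CInfPower E) where
  carrier := {f | zeroset f ∈ Φ.sets}
  zero_mem' := by
    have h : zeroset (0 : CInfPower E) = Set.univ := by ext x; simp [zeroset]
    simpa [h] using Φ.univ_mem
  add_mem' := by
    intro f g hf hg
    refine Φ.superset_mem _ (Φ.inter_mem _ hf _ hg) _ ⟨_, rfl⟩ ?_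
    rintro x ⟨h1, h2⟩
    simp only [zeroset, Set.mem_ofPred_eq] at h1 h2
    simp [zeroset, h1, h2]
  smul_mem' := by
    intro c f hf
    refine Φ.superset_mem _ hf _ ⟨_, rfl⟩ ?_
    intro x h1
    simp only [zeroset, Set.mem_ofPred_eq] at h1
    simp [zeroset, h1]

/-! ### Units in C∞-rings. -/

namespace CInfRing

variable {A : Type u} [CommRing A] [CInfRing A]

/-! Everything rests on `CInfPower.cinfRadical_eq`: f lies in the C∞-radical of I iff Z(f) = Z(g)
for some g ∈ I. Thus the C∞-radical ideals are the closed elements of the Galois connection. On the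
other side every filter is closed, because its members are zerosets, so the bijections and their
monotonicity are formal. Properness matches because a function without zeros is a unit, primality
because Z(fg) = Z(f) ∪ Z(g), and maximal ideals are closed because the closure of a proper ideal is
proper.

For the radical, let Z(g) ⊆ Z(f) and let g become 0 and f get an inverse t. Then g² + (ft - 1)² has
no zeros, hence is a unit, yet it evaluates to 0, so the target is zero (`subsingleton_of_op`).
Conversely, f becomes invertible in the ring of all functions modulo those that vanish on Z(g) \
Z(f) for some g ∈ I. If the ring of fractions is zero, so is this quotient, and some Z(g) \ Z(f) is
empty. -/

theorem op_const_one {n : ℕ} (a : Fin n → A) :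
    op (⟨fun _ => 1, contDiff_const⟩ : SmoothFn n) a = 1 := by
  -- The axioms mention only addition and multiplication. The identity 1 · x = x between unary
  -- functions makes the constant 1 neutral, and passing through arity 0 shows that its value
  -- depends neither on the arity nor on the arguments.
  have key : ∀ c : A, op (⟨fun _ => 1, contDiff_const⟩ : SmoothFn n) a * c = c := by
    intro c
    have h := op_mul_fn (⟨fun _ => 1, contDiff_const⟩ : SmoothFn 1) (SmoothFn.proj 0)
      (SmoothFn.proj 0) (fun x => by simp) (fun _ => c)
    have h0 : ∀ {m : ℕ} (b : Fin m → A), op (⟨fun _ => 1, contDiff_const⟩ : SmoothFn m) b =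
        op (⟨fun _ => 1, contDiff_const⟩ : SmoothFn 0) (fun i => i.elim0) := by
      intro m b
      have := op_comp (⟨fun _ => 1, contDiff_const⟩ : SmoothFn 0)
        (fun i : Fin 0 => (i.elim0 : SmoothFn m)) b
      refine Eq.trans ?_ (this.trans ?_)
      · rfl
      · congr 1
        ext i
        exact i.elim0
    rw [h0 a, ← h0 (fun _ : Fin 1 => c)]
    simpa [op_proj] using h.symm
  simpa using key 1

/-- A smooth function that vanishes nowhere takes units as values. -/
theorem isUnit_op {n : ℕ} (f : SmoothFn n) (hf : ∀ x, f.1 x ≠ 0) (a : Fin n → A) :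
    IsUnit (op f a) := by
  have h := op_mul_fn f ⟨fun x => (f.1 x)⁻¹, f.2.inv hf⟩ ⟨fun _ => 1, contDiff_const⟩
    (fun x => (mul_inv_cancel₀ (hf x)).symm) a
  rw [op_const_one] at h
  exact IsUnit.of_mul_eq_one _ h.symm

/-- If `g` only vanishes where `f` does, then `f(a)` is not invertible where `g(a) = 0`,
except in the zero ring. -/
theorem subsingleton_of_op {n : ℕ} (f g : SmoothFn n) (hfg : ∀ x, g.1 x = 0 → f.1 x = 0)
    (a : Fin n → A) (hg : op g a = 0) (hf : IsUnit (op f a)) : Subsingleton A := by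
  obtain ⟨b, hb⟩ := hf.exists_right_inv
  -- The extra last variable stands for the inverse `b` of `op f a`.
  let c : Fin (n + 1) → A := Fin.snoc a b
  let x : Fin n → SmoothFn (n + 1) := fun i => SmoothFn.proj i.castSucc
  let t : SmoothFn (n + 1) := SmoothFn.proj (Fin.last n)
  have hx : ∀ i, op (x i) c = a i := fun i => by simp [x, c, op_proj]
  have ht : op t c = b := by simp [t, c, op_proj]
  let one : SmoothFn (n + 1) := ⟨fun _ => 1, contDiff_const⟩
  let F := f.comp x
  let G := g.comp x
  have hF : op F c = op f a := by simp only [F, op_comp, hx]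
  have hG : op G c = 0 := by simp only [G, op_comp, hx, hg]
  let Ft : SmoothFn (n + 1) := ⟨fun z => F.1 z * t.1 z, F.2.mul t.2⟩
  let H : SmoothFn (n + 1) := ⟨fun z => Ft.1 z - 1, Ft.2.sub contDiff_const⟩
  let G2 : SmoothFn (n + 1) := ⟨fun z => G.1 z * G.1 z, G.2.mul G.2⟩
  let H2 : SmoothFn (n + 1) := ⟨fun z => H.1 z * H.1 z, H.2.mul H.2⟩
  -- `S` is G² + (Ft - 1)²: at a zero, G = 0 forces F = 0, and then Ft - 1 = -1.
  let S : SmoothFn (n + 1) := ⟨fun z => G2.1 z + H2.1 z, G2.2.add H2.2⟩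
  have hFt : op Ft c = 1 := by rw [op_mul_fn F t Ft (fun _ => rfl), hF, ht, hb]
  have hH : op H c = 0 := by
    have := op_add_fn H one Ft (fun z => by simp [H, one]) c
    rw [hFt, op_const_one] at this
    simpa using this
  have hS : op S c = 0 := by
    rw [op_add_fn G2 H2 S (fun _ => rfl), op_mul_fn G G G2 (fun _ => rfl),
      op_mul_fn H H H2 (fun _ => rfl), hG, hH]
    simp
  have hS0 : ∀ z, S.1 z ≠ 0 := by
    intro z hz
    obtain ⟨h1, h2⟩ := mul_self_add_mul_self_eq_zero.1 (show G.1 z * G.1 z + H.1 z * H.1 z = 0 from hz)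
    have h3 : F.1 z = 0 := hfg _ h1
    simp [H, Ft, h3] at h2
  have := isUnit_op S hS0 c
  rw [hS] at this
  exact isUnit_zero_iff.1 this |> subsingleton_of_zero_eq_one

/-- The zero ring as a C∞-ring. -/
instance punit : CInfRing PUnit.{u + 1} where
  op _ _ := PUnit.unit
  op_proj _ _ := rfl
  op_comp _ _ _ := rfl
  op_add _ _ := rfl
  op_mul _ _ := rfl

/-- The C∞-ring of all functions `X → ℝ`, with the pointwise operations. -/
instance pi (X : Type u) : CInfRing (X → ℝ) where
  op h f := fun x => h.1 fun i => f i x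
  op_proj _ _ := rfl
  op_comp _ _ _ := rfl
  op_add _ _ := rfl
  op_mul _ _ := rfl

end CInfRing

/-! ### Basic properties of C∞-homomorphisms. -/

namespace IsCInfHom

variable {A B : Type u} [CommRing A] [CInfRing A] [CommRing B] [CInfRing B] {φ : A → B}

theorem map_one (hφ : IsCInfHom φ) : φ 1 = 1 := by
  have := hφ 0 ⟨fun _ => 1, contDiff_const⟩ fun i => i.elim0
  rwa [CInfRing.op_const_one, CInfRing.op_const_one] at this

theorem map_add (hφ : IsCInfHom φ) (a b : A) : φ (a + b) = φ a + φ b := by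
  rw [← CInfRing.op_add, hφ, ← CInfRing.op_add]
  congr 1
  ext i
  fin_cases i <;> rfl

theorem map_zero (hφ : IsCInfHom φ) : φ 0 = 0 := by
  simpa using hφ.map_add 0 0

theorem subsingleton (hφ : IsCInfHom φ) [Subsingleton A] : Subsingleton B :=
  subsingleton_of_zero_eq_one (by
    rw [← hφ.map_zero, ← hφ.map_one, Subsingleton.elim (0 : A) 1])

end IsCInfHom

theorem isCInfHom_quotientMk {A : Type u} [CommRing A] [CInfRing A] (I : Ideal A) :
    IsCInfHom (Ideal.Quotient.mk I) := fun _ f a => (CInfRing.quotientOp_mk I f a).symm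

/-! ### The C∞-radical in `C∞(ℝ^E)`. -/

namespace CInfPower

variable {E : Type u}

/-- Finitely many elements of `C∞(ℝ^E)` are smooth functions of the same finitely many
coordinates; this is the case of two elements. -/
theorem exists_eq_op (f g : CInfPower E) :
    ∃ (n : ℕ) (a : Fin n → CInfPower E) (f' g' : SmoothFn n),
      f = CInfRing.op f' a ∧ g = CInfRing.op g' a ∧
        ∀ y : Fin n → ℝ, ∃ x, ∀ i, (a i).1 x = y i := by
  classical
  obtain ⟨f, D₁, f₁, hf₁, hf⟩ := f
  obtain ⟨g, D₂, g₁, hg₁, hg⟩ := g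
  let D := D₁ ∪ D₂
  let ε : D ≃ Fin D.card := D.equivFin
  refine ⟨D.card, fun i => ⟨fun x => x (ε.symm i), {((ε.symm i : D) : E)},
    fun y => y ⟨_, Finset.mem_singleton_self _⟩, contDiff_apply ℝ ℝ _, fun _ => rfl⟩,
    ⟨fun y => f₁ fun e => y (ε ⟨e, Finset.mem_union_left _ e.2⟩),
      hf₁.comp (contDiff_pi.2 fun e => contDiff_apply ℝ ℝ _)⟩,
    ⟨fun y => g₁ fun e => y (ε ⟨e, Finset.mem_union_right _ e.2⟩),
      hg₁.comp (contDiff_pi.2 fun e => contDiff_apply ℝ ℝ _)⟩, ?_, ?_, ?_⟩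
  · ext x
    simp [CInfRing.op, hf]
  · ext x
    simp [CInfRing.op, hg]
  -- Joint surjectivity of the coordinates: conditions on zerosets in ℝ^E become conditions on all
  -- of ℝⁿ.
  · intro y
    refine ⟨fun e => if h : e ∈ D then y (ε ⟨e, h⟩) else 0, fun i => ?_⟩
    simp

theorem isUnit_of_zeroset_eq_empty {f : CInfPower E} (hf : zeroset f = ∅) : IsUnit f := by
  obtain ⟨n, a, f', -, rfl, -, ha⟩ := exists_eq_op f f
  refine CInfRing.isUnit_op f' (fun y hy => ?_) a
  obtain ⟨x, hx⟩ := ha y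
  have : x ∈ zeroset (CInfRing.op f' a) := by
    change f'.1 (fun i => (a i).1 x) = 0
    rw [funext hx, hy]
  simp [hf] at this

/-- If `Z(g) ⊆ Z(f)`, then a C∞-homomorphism that kills `g` and inverts `f` has zero target. -/
theorem subsingleton_of_zeroset_subset {B : Type u} [CommRing B] [CInfRing B]
    {φ : CInfPower E → B} (hφ : IsCInfHom φ) {f g : CInfPower E} (hfg : zeroset g ⊆ zeroset f)
    (hg : φ g = 0) (hf : IsUnit (φ f)) : Subsingleton B := by
  obtain ⟨n, a, f', g', rfl, rfl, ha⟩ := exists_eq_op f g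
  rw [hφ] at hg hf
  refine CInfRing.subsingleton_of_op f' g' (fun y hy => ?_) _ hg hf
  obtain ⟨x, hx⟩ := ha y
  obtain rfl : (fun i => (a i).1 x) = y := funext hx
  exact hfg (show x ∈ zeroset (CInfRing.op g' a) from hy)

/-- The functions `ℝ^E → ℝ` that vanish on `Z(g) \ Z(f)` for some `g ∈ I`. -/
def vanishingIdeal (I : Ideal (CInfPower E)) (f : CInfPower E) : Ideal ((E → ℝ) → ℝ) where
  carrier := {h | ∃ g ∈ I, ∀ x, f.1 x ≠ 0 → g.1 x = 0 → h x = 0}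
  zero_mem' := ⟨0, I.zero_mem, fun _ _ _ => rfl⟩
  add_mem' := by
    rintro h₁ h₂ ⟨g₁, hg₁, H₁⟩ ⟨g₂, hg₂, H₂⟩
    -- The sum of squares has zeroset Z(g₁) ∩ Z(g₂).
    refine ⟨g₁ * g₁ + g₂ * g₂, I.add_mem (I.mul_mem_left _ hg₁) (I.mul_mem_left _ hg₂),
      fun x hx hgx => ?_⟩
    obtain ⟨h3, h4⟩ := mul_self_add_mul_self_eq_zero.1
      (show g₁.1 x * g₁.1 x + g₂.1 x * g₂.1 x = 0 from hgx)
    simp [H₁ x hx h3, H₂ x hx h4]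
  smul_mem' := by
    rintro c h ⟨g, hg, H⟩
    exact ⟨g, hg, fun x hx hgx => by simp [H x hx hgx]⟩

/-- The only place where the universal property of fractions is used. Testing it against a quotient
of the ring of all functions, smooth or not, avoids constructing the ring of fractions. -/
theorem cinfRadical_eq (I : Ideal (CInfPower E)) :
    cinfRadical I = (checkIdeal (hatFilter I) : Set (CInfPower E)) := by
  ext f
  constructor
  · rintro ⟨F, _, _, η, hη, _⟩
    let J := vanishingIdeal I f
    let ρ : CInfPower E →+* ((E → ℝ) → ℝ) ⧸ J :=
      (Ideal.Quotient.mk J).comp (CInfPower E).subtype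
    have hρ : ∀ g ∈ I, ρ g = 0 := fun g hg =>
      Ideal.Quotient.eq_zero_iff_mem.2 ⟨g, hg, fun _ _ h => h⟩
    have hlift : IsCInfHom (Ideal.Quotient.lift I ρ hρ) := by
      intro n h q
      choose a ha using fun i => Ideal.Quotient.mk_surjective (q i)
      obtain rfl : (fun i => Ideal.Quotient.mk I (a i)) = q := funext ha
      rw [← isCInfHom_quotientMk I]
      simp only [Ideal.Quotient.lift_mk]
      exact isCInfHom_quotientMk J n h fun i => (a i).1
    have hunit : IsUnit (ρ f) := by
      refine IsUnit.of_mul_eq_one (Ideal.Quotient.mk J fun x => (f.1 x)⁻¹) ?_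
      change Ideal.Quotient.mk J (f.1 * fun x => (f.1 x)⁻¹) = Ideal.Quotient.mk J 1
      -- The value of the inverse on Z(f) is irrelevant, since membership in `J` ignores Z(f).
      refine Ideal.Quotient.eq.2 ⟨0, I.zero_mem, fun x hx _ => ?_⟩
      simp [mul_inv_cancel₀ hx]
    obtain ⟨ψ, ⟨hψ, -⟩, -⟩ := hη.existsUnique_lift _ _ hlift (by
      rintro _ rfl
      simpa using hunit)
    have := hψ.subsingleton
    -- That 1 vanishes on Z(g) \ Z(f) means Z(g) ⊆ Z(f).
    obtain ⟨g, hg, H⟩ : (1 : (E → ℝ) → ℝ) ∈ J :=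
      Ideal.Quotient.eq_zero_iff_mem.1 (Subsingleton.elim _ _)
    refine (hatFilter I).superset_mem _ ⟨g, hg, rfl⟩ _ ⟨f, rfl⟩ fun x hx => ?_
    by_contra hfx
    exact one_ne_zero (H x hfx hx)
  · rintro ⟨g, hg, hfg⟩
    -- Every admissible target is zero, so the zero ring has the universal property.
    have key : ∀ (B : Type u) [CommRing B] [CInfRing B] (φ : CInfPower E ⧸ I → B),
        IsCInfHom φ → IsUnit (φ (Ideal.Quotient.mk I f)) → Subsingleton B := by
      intro B _ _ φ hφ hu
      refine subsingleton_of_zeroset_subset (φ := fun a => φ (Ideal.Quotient.mk I a))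
        (fun n h a => ?_) hfg.ge ?_ hu
      · beta_reduce
        rw [isCInfHom_quotientMk I, hφ]
      · rw [Ideal.Quotient.eq_zero_iff_mem.2 hg, hφ.map_zero]
    refine ⟨PUnit, inferInstance, CInfRing.punit, fun _ => PUnit.unit,
      ⟨fun _ _ _ => rfl, fun _ _ => isUnit_of_subsingleton _, ?_⟩, inferInstance⟩
    intro B _ _ φ hφ hu
    have := key B φ hφ (hu _ rfl)
    exact ⟨fun _ => 0, ⟨fun _ _ _ => Subsingleton.elim _ _, fun _ => Subsingleton.elim _ _⟩,
      fun _ _ => Subsingleton.elim _ _⟩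

end CInfPower

/-! ### The correspondence between ideals and filters. -/

section Correspondence

variable {E : Type u}

theorem zeroset_mul (f g : CInfPower E) : zeroset (f * g) = zeroset f ∪ zeroset g := by
  ext x
  simp [zeroset]

theorem zeroset_one : zeroset (1 : CInfPower E) = ∅ := by
  ext x
  simp [zeroset]

theorem isCInfRadical_iff {I : Ideal (CInfPower E)} :
    IsCInfRadical I ↔ checkIdeal (hatFilter I) = I := by
  rw [IsCInfRadical, CInfPower.cinfRadical_eq, SetLike.coe_set_eq]

theorem gc_hatFilter_checkIdeal :
    GaloisConnection (hatFilter (E := E)) (checkIdeal (E := E)) := by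
  intro I Φ
  constructor
  · exact fun h f hf => h ⟨f, hf, rfl⟩
  · rintro h _ ⟨f, hf, rfl⟩
    exact h hf

theorem hatFilter_checkIdeal (Φ : ZerosetFilter E) : hatFilter (checkIdeal Φ) = Φ := by
  refine le_antisymm (gc_hatFilter_checkIdeal.l_u_le Φ) fun F hF => ?_
  obtain ⟨f, rfl⟩ := Φ.isZeroset F hF
  exact ⟨f, hF, rfl⟩

theorem isCInfRadical_checkIdeal (Φ : ZerosetFilter E) : IsCInfRadical (checkIdeal Φ) :=
  isCInfRadical_iff.2 (by rw [hatFilter_checkIdeal])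

theorem ZerosetFilter.isProper_iff {Φ : ZerosetFilter E} : Φ.IsProper ↔ ∅ ∉ Φ.sets := by
  refine not_congr ⟨fun h => ?_, fun h => ?_⟩
  · rw [h]
    exact ⟨1, zeroset_one.symm⟩
  · exact Set.Subset.antisymm (fun F hF => Φ.isZeroset F hF)
      fun F hF => Φ.superset_mem _ h _ hF (Set.empty_subset F)

/-- An element of I with empty zeroset is a unit, so ∅ can occur only when I is the whole ring. -/
theorem hatFilter_isProper_iff {I : Ideal (CInfPower E)} : (hatFilter I).IsProper ↔ I ≠ ⊤ := by
  rw [ZerosetFilter.isProper_iff]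
  refine not_congr ⟨?_, fun h => ?_⟩
  · rintro ⟨f, hf, h⟩
    exact I.eq_top_of_isUnit_mem hf (CInfPower.isUnit_of_zeroset_eq_empty h.symm)
  · exact ⟨1, h ▸ Submodule.mem_top, zeroset_one.symm⟩

theorem checkIdeal_ne_top_iff {Φ : ZerosetFilter E} : checkIdeal Φ ≠ ⊤ ↔ Φ.IsProper := by
  rw [← hatFilter_isProper_iff, hatFilter_checkIdeal]

theorem checkIdeal_prime_iff {Φ : ZerosetFilter E} :
    (∀ f g : CInfPower E, f * g ∈ checkIdeal Φ → f ∈ checkIdeal Φ ∨ g ∈ checkIdeal Φ) ↔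
      Φ.IsPrime := by
  constructor
  · rintro h _ _ ⟨f, rfl⟩ ⟨g, rfl⟩ hfg
    rw [← zeroset_mul] at hfg
    exact h f g hfg
  · intro h f g hfg
    exact h _ _ ⟨f, rfl⟩ ⟨g, rfl⟩ (zeroset_mul f g ▸ hfg)

/-- The closure of I is proper and contains I, so maximality makes them equal. -/
theorem Ideal.IsMaximal.isCInfRadical {I : Ideal (CInfPower E)} (hI : I.IsMaximal) :
    IsCInfRadical I :=
  isCInfRadical_iff.2 (hI.eq_of_le
    (checkIdeal_ne_top_iff.2 (hatFilter_isProper_iff.2 hI.ne_top))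
    (gc_hatFilter_checkIdeal.le_u_l I)).symm

theorem checkIdeal_isMaximal_iff {Φ : ZerosetFilter E} :
    (checkIdeal Φ).IsMaximal ↔ Φ.IsMaximal := by
  constructor
  · intro h
    refine ⟨checkIdeal_ne_top_iff.1 h.ne_top, fun Ψ hΨ hle => ?_⟩
    have := h.eq_of_le (checkIdeal_ne_top_iff.2 hΨ) (gc_hatFilter_checkIdeal.monotone_u hle)
    rw [← hatFilter_checkIdeal Φ, this, hatFilter_checkIdeal]
  · intro h
    refine Ideal.isMaximal_def.2 ⟨checkIdeal_ne_top_iff.2 h.prop, fun J hJ => ?_⟩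
    by_contra hJt
    have hle : Φ ≤ hatFilter J := by
      conv_lhs => rw [← hatFilter_checkIdeal Φ]
      exact gc_hatFilter_checkIdeal.monotone_l hJ.le
    -- Maximality of Φ gives Ĵ ≤ Φ, which by adjunction puts J inside `checkIdeal Φ`.
    exact hJ.not_ge (gc_hatFilter_checkIdeal.le_u (h.2 (hatFilter_isProper_iff.2 hJt) hle))

/-- The order isomorphism between C∞-radical ideals and filters of zerosets, restricted to
classes of ideals and of filters that correspond to each other. -/
def checkOrderIso (p : Ideal (CInfPower E) → Prop) (q : ZerosetFilter E → Prop)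
    (hp : ∀ I, p I → IsCInfRadical I) (hpq : ∀ Φ, p (checkIdeal Φ) ↔ q Φ) :
    {I : Ideal (CInfPower E) // p I} ≃o {Φ : ZerosetFilter E // q Φ} where
  -- `hpq` applies because I, being closed, is `checkIdeal` of its own filter.
  toFun I := ⟨hatFilter I.1, (hpq _).1 (by
    rw [isCInfRadical_iff.1 (hp _ I.2)]
    exact I.2)⟩
  invFun Φ := ⟨checkIdeal Φ.1, (hpq _).2 Φ.2⟩
  left_inv I := Subtype.ext (isCInfRadical_iff.1 (hp _ I.2))
  right_inv Φ := Subtype.ext (hatFilter_checkIdeal Φ.1)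
  map_rel_iff' := by
    intro I J
    change hatFilter I.1 ≤ hatFilter J.1 ↔ I.1 ≤ J.1
    -- By adjunction Î ≤ Ĵ says that I lies in the closure of J, which is J.
    rw [gc_hatFilter_checkIdeal.le_iff_le, isCInfRadical_iff.1 (hp _ J.2)]

end Correspondence

/-- The maps `I ↦ Î`, `Φ ↦ Φ̌` form a Galois connection and restrict to mutually inverse
(order-preserving) bijections between: C∞-radical ideals and filters of zerosets; proper ones;
maximal ideals and maximal filters; prime C∞-radical ideals and prime filters, first with and
then without the improper ones. -/
theorem proposition2p14 (E : Type u) :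
    GaloisConnection (hatFilter (E := E)) (checkIdeal (E := E)) ∧
    (∃ e : {I : Ideal (CInfPower E) // IsCInfRadical I} ≃o ZerosetFilter E,
      (∀ I, e I = hatFilter I.1) ∧ (∀ Φ, (e.symm Φ).1 = checkIdeal Φ)) ∧
    (∃ e : {I : Ideal (CInfPower E) // IsCInfRadical I ∧ I ≠ ⊤} ≃o
        {Φ : ZerosetFilter E // Φ.IsProper},
      (∀ I, (e I).1 = hatFilter I.1) ∧ (∀ Φ, (e.symm Φ).1 = checkIdeal Φ.1)) ∧
    (∃ e : {I : Ideal (CInfPower E) // I.IsMaximal} ≃ {Φ : ZerosetFilter E // Φ.IsMaximal},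
      (∀ I, (e I).1 = hatFilter I.1) ∧ (∀ Φ, (e.symm Φ).1 = checkIdeal Φ.1)) ∧
    (∃ e : {I : Ideal (CInfPower E) //
          IsCInfRadical I ∧ ∀ f g : CInfPower E, f * g ∈ I → f ∈ I ∨ g ∈ I} ≃o
        {Φ : ZerosetFilter E // Φ.IsPrime},
      (∀ I, (e I).1 = hatFilter I.1) ∧ (∀ Φ, (e.symm Φ).1 = checkIdeal Φ.1)) ∧
    (∃ e : {I : Ideal (CInfPower E) // IsCInfRadical I ∧ I.IsPrime} ≃o
        {Φ : ZerosetFilter E // Φ.IsProper ∧ Φ.IsPrime},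
      (∀ I, (e I).1 = hatFilter I.1) ∧ (∀ Φ, (e.symm Φ).1 = checkIdeal Φ.1)) := by
  refine ⟨gc_hatFilter_checkIdeal, ?_, ?_, ?_, ?_, ?_⟩
  · let e := checkOrderIso (E := E) IsCInfRadical (fun _ => True) (fun _ h => h)
      fun Φ => iff_true_intro (isCInfRadical_checkIdeal Φ)
    exact ⟨e.trans
      { toFun := Subtype.val
        invFun := fun Φ => ⟨Φ, trivial⟩
        left_inv := fun _ => rfl
        right_inv := fun _ => rfl
        map_rel_iff' := Iff.rfl }, fun _ => rfl, fun _ => rfl⟩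
  · exact ⟨checkOrderIso _ _ (fun _ h => h.1) fun Φ =>
      (and_iff_right (isCInfRadical_checkIdeal Φ)).trans checkIdeal_ne_top_iff,
      fun _ => rfl, fun _ => rfl⟩
  · exact ⟨(checkOrderIso _ _ (fun _ h => h.isCInfRadical) fun _ =>
      checkIdeal_isMaximal_iff).toEquiv, fun _ => rfl, fun _ => rfl⟩
  · exact ⟨checkOrderIso _ _ (fun _ h => h.1) fun Φ =>
      (and_iff_right (isCInfRadical_checkIdeal Φ)).trans checkIdeal_prime_iff,
      fun _ => rfl, fun _ => rfl⟩
  · refine ⟨checkOrderIso _ _ (fun _ h => h.1) fun Φ =>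
      (and_iff_right (isCInfRadical_checkIdeal Φ)).trans ?_, fun _ => rfl, fun _ => rfl⟩
    -- `Ideal.IsPrime` includes properness, which here corresponds to `Φ.IsProper`.
    rw [Ideal.isPrime_iff, checkIdeal_ne_top_iff, ← checkIdeal_prime_iff]
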